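/- Let $\mathsf X$ be a Polish space with its Borel $\sigma$-algebra. Let $V:\mathsf X\to[1,\infty)$ be measurable and unbounded, put $v=e^V$ and $C_d=\{x: V(x)\le d\}$, write $\eta(\varphi)=\int\varphi\,d\eta$, let $\mathcal P_v$ be the set of probability measures $\eta$ on $\mathsf X$ with $\eta(v)<\infty$, and for a signed measure $s$ let $\|s\|_v=\sup\{s(\varphi):\varphi \text{ measurable},\ |\varphi|\le v\}$. Fix $\delta>0$, $\underline d\ge 1$ and, for every $d\ge\underline d$, real numbers $b_d$ and $0<\epsilon_d^-\le\epsilon_d^+<\infty$ and a measure $\nu_d\in\mathcal P_v$ with $\nu_d(C_r)>0$ for all $r\in[\underline d,d]$. Let $\mu\in\mathcal P_v$. Consider Markov kernels $(M_n)_{n\ge1}$ on $\mathsf X$ and strictly positive measurable functions $(G_n)_{n\ge0}$ on $\mathsf X$, put $Q_n(x,dx')=G_{n-1}(x)M_n(x,dx')$ and $Q_{0,n}=Q_1\cdots Q_n$ ($Q_{0,0}=\mathrm{Id}$), and for a probability measure $\mu$ let $\eta_n^{(\mu)}=\mu Q_{0,n}/\mu Q_{0,n}(1)$. Call $(M_n,G_n)$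 admissible if for all $n\ge1$ and $d\ge\underline d$: (a) $Q_n(e^V)(x)\le \exp\big(V(x)(1-\delta)+b_d\mathbb 1_{C_d}(x)\big)$ for all $x\in\mathsf X$; (b) $Q_n(x,C_d)>0$ for all $x\in\mathsf X$, and $Q_n(x,C_d\cap A)\ge\epsilon_d^-\nu_d(C_d\cap A)$ for all $x\in C_d$ and Borel $A$; (c) $Q_n(x,C_d\cap A)\le\epsilon_d^+\nu_d(C_d\cap A)$ for all $x\in C_d$ and Borel $A$. Then there is $\rho\in[0,1)$, depending only on $\mu$ and on $V,\delta,\underline d,(b_d),(\epsilon_d^\pm),(\nu_d)$, such that for every $\mu'\in\mathcal P_v$ there is $c_{\mu,\mu'}<\infty$, depending only on the same quantities and on $\mu'$, such that for every admissible $(M_n,G_n)$ and all $n\ge0$ $$\big\|\eta_n^{(\mu)}-\eta_n^{(\mu')}\big\|_v\le\rho^n\,c_{\mu,\mu'}\,\mu(v)\,\mu'(v).$$ -/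

import Mathlib

open MeasureTheory ProbabilityTheory
open scoped ENNReal NNReal

/-- The data of a (non-homogeneous) Feynman--Kac model on `X`: Markov kernels and strictly positive,
real-valued, measurable potential functions.  `M n` is the kernel of the transition from time `n`
to time `n + 1`, i.e. the kernel usually written `M_{n+1}`; `G n` is the potential `G_n`. -/
structure FeynmanKac (X : Type*) [MeasurableSpace X] where
  M : ℕ → Kernel X X
  G : ℕ → X → ℝ
  markov : ∀ n, IsMarkovKernel (M n)
  measurable_G : ∀ n, Measurable (G n)
  G_pos : ∀ n x, 0 < G n x

namespace FeynmanKac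

variable {X : Type*} [MeasurableSpace X]

/-- `F.Q n` is the kernel `Q_{n+1}(x, dx') = G_n(x) M_{n+1}(x, dx')`, so that the family
`(F.Q n)_{n ≥ 0}` is the family `(Q_n)_{n ≥ 1}`. -/
noncomputable def Q (F : FeynmanKac X) (n : ℕ) : Kernel X X where
  toFun x := ENNReal.ofReal (F.G n x) • F.M n x
  measurable' := by
    refine Measure.measurable_of_measurable_coe _ fun s hs => ?_
    simp only [Measure.smul_apply, smul_eq_mul]
    exact (F.measurable_G n).ennreal_ofReal.mul ((F.M n).measurable_coe hs)

/-- `F.Q0 n` is the kernel `Q_{0,n} = Q_1 Q_2 ⋯ Q_n` (with `Q_{0,0} = Id`). -/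
noncomputable def Q0 (F : FeynmanKac X) : ℕ → Kernel X X
  | 0 => Kernel.id
  | n + 1 => (F.Q n).comp (Q0 F n)

/-- The unnormalised measure `γ_n = μ Q_{0,n}`. -/
noncomputable def gamma (F : FeynmanKac X) (μ : Measure X) (n : ℕ) : Measure X :=
  μ.bind (F.Q0 n)

/-- The normalised (predictive) measure `η_n = μ Q_{0,n} / μ Q_{0,n}(1)` started from `μ`. -/
noncomputable def eta (F : FeynmanKac X) (μ : Measure X) (n : ℕ) : Measure X :=
  (F.gamma μ n Set.univ)⁻¹ • F.gamma μ n

instance isFiniteMeasure_eta (F : FeynmanKac X) (μ : Measure X) (n : ℕ) :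
    IsFiniteMeasure (F.eta μ n) :=
  ⟨by
    simp only [eta, Measure.smul_apply, smul_eq_mul]
    exact lt_of_le_of_lt (ENNReal.inv_mul_le_one _) ENNReal.one_lt_top⟩

end FeynmanKac

section Weighted

variable {X : Type*} [MeasurableSpace X]

/-- `integralExp V η = η(v) = ∫ v dη` for `v = e^V`, as an extended nonnegative real. -/
noncomputable def integralExp (V : X → ℝ) (η : Measure X) : ℝ≥0∞ :=
  ∫⁻ x, ENNReal.ofReal (Real.exp (V x)) ∂η

/-- `η ∈ 𝒫_v` for `v = e^V`: `η` is a probability measure with `η(v) < ∞`. -/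
def MemP (V : X → ℝ) (η : Measure X) : Prop :=
  IsProbabilityMeasure η ∧ integralExp V η < ∞

/-- The `v`-norm of a signed measure, for `v = e^V`: the supremum of `s(φ) = ∫ φ ds` over all
measurable `φ : X → ℝ` with `|φ| ≤ v`. -/
noncomputable def vNorm (V : X → ℝ) (s : SignedMeasure X) : ℝ≥0∞ :=
  ⨆ φ : {φ : X → ℝ // Measurable φ ∧ ∀ x, |φ x| ≤ Real.exp (V x)},
    ENNReal.ofReal (∫ᵛ x, φ.1 x ∂<•s)

/-- The sublevel set `C_d = {x : V x ≤ d}`. -/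
def sublevel (V : X → ℝ) (d : ℝ) : Set X := {x | V x ≤ d}

/-- The multiplicative drift condition, for the given `V`, `δ`, `dlow` and
`d ↦ b d` (only the values `b d` with `d ≥ dlow` matter). -/
structure DriftCondition (F : FeynmanKac X) (V : X → ℝ) (δ dlow : ℝ) (b : ℝ → ℝ) : Prop where
  measurable_V : Measurable V
  one_le_V : ∀ x, 1 ≤ V x
  unbounded_V : ¬ BddAbove (Set.range V)
  delta_pos : 0 < δ
  one_le_dlow : 1 ≤ dlow
  drift : ∀ d, dlow ≤ d → ∀ n x, integralExp V (F.Q n x) ≤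
    ENNReal.ofReal (Real.exp (V x * (1 - δ) + (sublevel V d).indicator (fun _ => b d) x))

/-- The condition on the initial law: `μ ∈ 𝒫_v`. -/
def InitialCondition (V : X → ℝ) (μ : Measure X) : Prop := MemP V μ

/-- The local minorization condition, for the given `d ↦ εm d` (that is `ε_d⁻`)
and `d ↦ ν d`. -/
structure MinorizationCondition (F : FeynmanKac X) (V : X → ℝ) (dlow : ℝ) (εm : ℝ → ℝ) (ν : ℝ → Measure X) :
    Prop where
  accessible : ∀ d, dlow ≤ d → ∀ n x, 0 < F.Q n x (sublevel V d)
  eps_pos : ∀ d, dlow ≤ d → 0 < εm d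
  nu_mem : ∀ d, dlow ≤ d → MemP V (ν d)
  minorization : ∀ d, dlow ≤ d → ∀ n, ∀ x ∈ sublevel V d, ∀ A, MeasurableSet A →
    ENNReal.ofReal (εm d) * ν d (sublevel V d ∩ A) ≤ F.Q n x (sublevel V d ∩ A)
  nu_pos : ∀ d, dlow ≤ d → ∀ r, dlow ≤ r → r ≤ d → 0 < ν d (sublevel V r)

/-- The local majorization condition, for the given `d ↦ εp d` (that is `ε_d⁺`),
with `ε_d⁻` and `ν_d` as in the minorization condition. -/
structure MajorizationCondition (F : FeynmanKac X) (V : X → ℝ) (dlow : ℝ) (εm εp : ℝ → ℝ) (ν : ℝ → Measure X) :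
    Prop where
  eps_le : ∀ d, dlow ≤ d → εm d ≤ εp d
  majorization : ∀ d, dlow ≤ d → ∀ n, ∀ x ∈ sublevel V d, ∀ A, MeasurableSet A →
    F.Q n x (sublevel V d ∩ A) ≤ ENNReal.ofReal (εp d) * ν d (sublevel V d ∩ A)

end Weighted

/-! After clearing denominators, `η_n^μ(f) - η_n^μ'(f)` has as numerator the integral against `μ ⊗
μ'` of the antisymmetric function `pairDiff f 0 n`, and `pairDiff` is propagated backwards by the
product kernels `Q(x,·) ⊗ Q(y,·)`. So it suffices to bound `pairDiff` when two independent copies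
run together.

From a pair in `C_d × C_d`, both kernels lie on `C_d` between `ε⁻ν` and `ε⁺ν`. Their product
contains `(ε⁻)² ν ⊗ ν`, which antisymmetric functions do not see, and discarding it gains a factor
`w < 1` (`abs_integral_prod_le_of_antisymm`). From a pair outside, the drift gains `θ = e^{-δd}`.
Counting visits outside gives (`abs_pairDiff_le_pow`), with `E = e^{2B}`, `|pairDiff| ≤ 2
(w^{m-1-2J} Qv ⊗ Qv + θ^J E^m v ⊗ v)`.

Dividing by the masses, the first term is controlled by `γ_n(v) ≤ C γ_n(1)` and the second by
`γ_n(1) ≥ c l^n` (`exists_gamma_bounds`). Both `E` and `l` are fixed at level `dlow`, so `d` can be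
chosen afterwards, large enough that with `J = ⌊n/4⌋` the gain `θ^J` beats `(E / l²)^n`. Neither `l`
nor `E` involves the initial laws, which is why `ρ` does not depend on `μ'`. -/

/-! ### Cancellation for antisymmetric integrands. -/

/-- Antisymmetric functions integrate to zero against `ν ⊗ ν`, so a common component of that form can be
removed from a product measure before taking absolute values. -/
lemma abs_integral_prod_le_of_antisymm {X : Type*} [MeasurableSpace X] {α β ν : Measure X}
    [IsFiniteMeasure α] [IsFiniteMeasure β] [IsFiniteMeasure ν] {e₁ e₂ : ℝ} (he₁ : 0 < e₁)
    (he : e₁ ≤ e₂) (hα₁ : ENNReal.ofReal e₁ • ν ≤ α) (hα₂ : α ≤ ENNReal.ofReal e₂ • ν)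
    (hβ₁ : ENNReal.ofReal e₁ • ν ≤ β) (hβ₂ : β ≤ ENNReal.ofReal e₂ • ν)
    {D : X × X → ℝ} (hD : Integrable D (α.prod β)) (hanti : ∀ z, D z.swap = -D z) :
    |∫ z, D z ∂α.prod β| ≤ (1 - (e₁ / e₂) ^ 2) * ∫ z, |D z| ∂α.prod β := by
  have he₂ : 0 < e₂ := he₁.trans_le he
  have hsq : ∀ e : ℝ, 0 < e → (ENNReal.ofReal e • ν).prod (ENNReal.ofReal e • ν) =
      ENNReal.ofReal (e ^ 2) • ν.prod ν := by
    intro e h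
    rw [Measure.prod_smul_left, Measure.prod_smul_right, smul_smul, ← ENNReal.ofReal_mul h.le, sq]
  set N : Measure (X × X) := ENNReal.ofReal (e₁ ^ 2) • ν.prod ν with hN
  have hNP : N ≤ α.prod β := by
    rw [hN, ← hsq e₁ he₁]; exact Measure.prod_mono hα₁ hβ₁
  have hPN : α.prod β ≤ ENNReal.ofReal ((e₂ / e₁) ^ 2) • N := by
    refine (Measure.prod_mono hα₂ hβ₂).trans (le_of_eq ?_)
    rw [hsq e₂ he₂, hN, smul_smul, ← ENNReal.ofReal_mul (by positivity)]
    congr 2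
    field_simp
  have hNfin : IsFiniteMeasure N := isFiniteMeasure_of_le _ hNP
  have hDN : Integrable D N := hD.mono_measure hNP
  have hzero : ∫ z, D z ∂N = 0 := by
    have h : ∫ z, D z ∂(ν.prod ν) = 0 := by
      have h1 := integral_prod_swap (μ := ν) (ν := ν) D
      simp only [hanti, integral_neg] at h1
      linarith
    rw [hN, integral_smul_measure, h, smul_zero]
  have hsub : α.prod β - N + N = α.prod β := Measure.sub_add_cancel_of_le hNP
  have hle : α.prod β - N ≤ α.prod β := Measure.sub_le
  have hDs : Integrable D (α.prod β - N) := hD.mono_measure hle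
  have h1 : ∫ z, D z ∂α.prod β = ∫ z, D z ∂(α.prod β - N) := by
    conv_lhs => rw [← hsub]
    rw [integral_add_measure hDs hDN, hzero, add_zero]
  have h2 : ∫ z, |D z| ∂α.prod β = ∫ z, |D z| ∂(α.prod β - N) + ∫ z, |D z| ∂N := by
    conv_lhs => rw [← hsub]
    rw [integral_add_measure hDs.abs hDN.abs]
  have h3 : ∫ z, |D z| ∂α.prod β ≤ (e₂ / e₁) ^ 2 * ∫ z, |D z| ∂N := by
    have := integral_mono_measure (f := fun z => |D z|) hPN (by filter_upwards with z; positivity)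
      (hDN.abs.smul_measure ENNReal.ofReal_ne_top)
    rwa [integral_smul_measure, ENNReal.toReal_ofReal (by positivity), smul_eq_mul] at this
  -- The upper bounds on `α` and `β` enter here: the discarded part `N` carries at least the share
  -- `(e₁ / e₂)²` of the integral of `|D|`.
  have h4 : (e₁ / e₂) ^ 2 * ∫ z, |D z| ∂α.prod β ≤ ∫ z, |D z| ∂N := by
    calc (e₁ / e₂) ^ 2 * ∫ z, |D z| ∂α.prod β
        ≤ (e₁ / e₂) ^ 2 * ((e₂ / e₁) ^ 2 * ∫ z, |D z| ∂N) := by gcongr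
      _ = ∫ z, |D z| ∂N := by field_simp
  rw [h1]
  have h5 := abs_integral_le_integral_abs (f := D) (μ := α.prod β - N)
  linarith

/-- Version of `abs_integral_prod_le_of_antisymm` in which the two measures are only comparable to a
multiple of `ν` on a set `C`, with a majorant of the integrand. -/
lemma abs_integral_prod_le_of_local {X : Type*} [MeasurableSpace X] {α β ν : Measure X}
    [IsFiniteMeasure α] [IsFiniteMeasure β] [IsFiniteMeasure ν] {C : Set X} (hC : MeasurableSet C)
    {e₁ e₂ w : ℝ} (he₁ : 0 < e₁) (he : e₁ ≤ e₂) (hw : 1 - (e₁ / e₂) ^ 2 ≤ w)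
    (hα₁ : ENNReal.ofReal e₁ • ν.restrict C ≤ α.restrict C)
    (hα₂ : α.restrict C ≤ ENNReal.ofReal e₂ • ν.restrict C)
    (hβ₁ : ENNReal.ofReal e₁ • ν.restrict C ≤ β.restrict C)
    (hβ₂ : β.restrict C ≤ ENNReal.ofReal e₂ • ν.restrict C)
    {D h : X × X → ℝ} (hD : Integrable D (α.prod β)) (hh : Integrable h (α.prod β))
    (hanti : ∀ z, D z.swap = -D z) (hin : ∀ z ∈ C ×ˢ C, w * |D z| ≤ h z)
    (hout : ∀ z ∉ C ×ˢ C, |D z| ≤ h z) :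
    |∫ z, D z ∂α.prod β| ≤ ∫ z, h z ∂α.prod β := by
  have hCC : MeasurableSet (C ×ˢ C) := hC.prod hC
  rw [← integral_add_compl hCC hD, ← integral_add_compl hCC hh]
  refine (abs_add_le _ _).trans (add_le_add ?_ ?_)
  · have h1 := abs_integral_prod_le_of_antisymm he₁ he hα₁ hα₂ hβ₁ hβ₂
      (by rw [Measure.prod_restrict]; exact hD.restrict) hanti
    rw [Measure.prod_restrict] at h1
    calc |∫ z in C ×ˢ C, D z ∂α.prod β|
        ≤ w * ∫ z in C ×ˢ C, |D z| ∂α.prod β :=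
          h1.trans (mul_le_mul_of_nonneg_right hw (integral_nonneg fun z => abs_nonneg _))
      _ = ∫ z in C ×ˢ C, w * |D z| ∂α.prod β := (integral_const_mul _ _).symm
      _ ≤ ∫ z in C ×ˢ C, h z ∂α.prod β :=
          setIntegral_mono_on (hD.abs.const_mul w).integrableOn hh.integrableOn hCC hin
  · calc |∫ z in (C ×ˢ C)ᶜ, D z ∂α.prod β|
        ≤ ∫ z in (C ×ˢ C)ᶜ, |D z| ∂α.prod β := abs_integral_le_integral_abs
      _ ≤ ∫ z in (C ×ˢ C)ᶜ, h z ∂α.prod β :=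
          setIntegral_mono_on hD.abs.integrableOn hh.integrableOn hCC.compl hout

/-! ### The unnormalised semigroup under the drift. -/

namespace FeynmanKac

variable {X : Type*} [MeasurableSpace X] (F : FeynmanKac X)

lemma Q_apply (n : ℕ) (x : X) : F.Q n x = ENNReal.ofReal (F.G n x) • F.M n x := rfl

instance isFiniteMeasure_Q (n : ℕ) (x : X) : IsFiniteMeasure (F.Q n x) := by
  have := F.markov n
  rw [Q_apply]
  exact Measure.smul_finite _ ENNReal.ofReal_ne_top

lemma gamma_zero (μ : Measure X) : F.gamma μ 0 = μ := by
  simp [gamma, Q0]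

lemma gamma_succ (μ : Measure X) (n : ℕ) : F.gamma μ (n + 1) = (F.gamma μ n).bind (F.Q n) := by
  simp only [gamma, Q0]
  exact Measure.comp_assoc.symm

/-- `F.back f k m` is the function `Q_{k+1} ⋯ Q_{k+m} f`. -/
noncomputable def back (f : X → ℝ) : ℕ → ℕ → X → ℝ
  | _, 0 => f
  | k, m + 1 => fun x => ∫ y, back f (k + 1) m y ∂F.Q k x

lemma back_succ (f : X → ℝ) (k m : ℕ) (x : X) :
    F.back f k (m + 1) x = ∫ y, F.back f (k + 1) m y ∂F.Q k x := rfl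

lemma measurable_back {f : X → ℝ} (hf : Measurable f) (k m : ℕ) : Measurable (F.back f k m) := by
  induction m generalizing k with
  | zero => exact hf
  | succ m ih => exact ((ih (k + 1)).stronglyMeasurable.integral_kernel).measurable

/-- The drift inequality `Q_n(e^V) ≤ e^{(1-δ)V + B}`, without localisation. -/
def GlobalDrift (V : X → ℝ) (δ B : ℝ) : Prop :=
  ∀ n x, integralExp V (F.Q n x) ≤ ENNReal.ofReal (Real.exp (V x * (1 - δ) + B))

variable {F} {V : X → ℝ} {δ B : ℝ}

lemma integrable_of_abs_le_exp {η : Measure X} (hV : Measurable V) (h : integralExp V η < ∞)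
    {f : X → ℝ} (hf : Measurable f) {K : ℝ} (hK : ∀ x, |f x| ≤ K * Real.exp (V x)) :
    Integrable f η := by
  have hv : Integrable (fun x => Real.exp (V x)) η :=
    ⟨(Real.measurable_exp.comp hV).aestronglyMeasurable, by
      rw [hasFiniteIntegral_iff_ofReal (by filter_upwards with x; positivity)]; exact h⟩
  exact (hv.const_mul K).mono' hf.aestronglyMeasurable (by filter_upwards with x using hK x)

lemma integrable_exp {η : Measure X} (hV : Measurable V) (h : integralExp V η < ∞) :
    Integrable (fun x => Real.exp (V x)) η :=
  integrable_of_abs_le_exp hV h (Real.measurable_exp.comp hV) (K := 1) (by simp)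

lemma ofReal_integral_exp {η : Measure X} (hV : Measurable V) (h : integralExp V η < ∞) :
    ENNReal.ofReal (∫ x, Real.exp (V x) ∂η) = integralExp V η :=
  ofReal_integral_eq_lintegral_ofReal (integrable_exp hV h)
    (by filter_upwards with x; positivity)

namespace GlobalDrift

lemma integralExp_lt_top (h : F.GlobalDrift V δ B) (n : ℕ) (x : X) :
    integralExp V (F.Q n x) < ∞ :=
  (h n x).trans_lt ENNReal.ofReal_lt_top

lemma integral_exp_le (h : F.GlobalDrift V δ B) (hV : Measurable V) (n : ℕ) (x : X) :
    ∫ y, Real.exp (V y) ∂F.Q n x ≤ Real.exp (V x * (1 - δ) + B) := by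
  rw [← ENNReal.ofReal_le_ofReal_iff (by positivity),
    ofReal_integral_exp hV (h.integralExp_lt_top n x)]
  exact h n x

lemma integral_exp_le' (h : F.GlobalDrift V δ B) (hV : Measurable V) (hV0 : ∀ x, 0 ≤ V x)
    (hδ : 0 ≤ δ) (n : ℕ) (x : X) :
    ∫ y, Real.exp (V y) ∂F.Q n x ≤ Real.exp B * Real.exp (V x) := by
  refine (h.integral_exp_le hV n x).trans ?_
  rw [← Real.exp_add]
  have := mul_nonneg (hV0 x) hδ
  exact Real.exp_le_exp.2 (by linarith)

/-- Iterates the drift with its gain `e^{-δV}` thrown away. The resulting growth `e^{Bm}` is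
harmless, because `B` will not depend on the level `d` used for the coupling. -/
lemma abs_back_le (h : F.GlobalDrift V δ B) (hV : Measurable V) (hV0 : ∀ x, 0 ≤ V x)
    (hδ : 0 ≤ δ) {f : X → ℝ} (hf : Measurable f) (hfv : ∀ x, |f x| ≤ Real.exp (V x))
    (k m : ℕ) (x : X) : |F.back f k m x| ≤ Real.exp B ^ m * Real.exp (V x) := by
  induction m generalizing k x with
  | zero => simpa [back] using hfv x
  | succ m ih =>
    have hint := integrable_of_abs_le_exp hV (h.integralExp_lt_top k x)
      (F.measurable_back hf (k + 1) m) (ih (k + 1))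
    calc |F.back f k (m + 1) x| ≤ ∫ y, |F.back f (k + 1) m y| ∂F.Q k x := by
          rw [back_succ]; exact abs_integral_le_integral_abs
      _ ≤ ∫ y, Real.exp B ^ m * Real.exp (V y) ∂F.Q k x :=
          integral_mono hint.abs ((integrable_exp hV (h.integralExp_lt_top k x)).const_mul _)
            (ih (k + 1))
      _ ≤ Real.exp B ^ m * (Real.exp B * Real.exp (V x)) := by
          rw [integral_const_mul]
          gcongr
          exact h.integral_exp_le' hV hV0 hδ k x
      _ = Real.exp B ^ (m + 1) * Real.exp (V x) := by ring

lemma integrable_back (h : F.GlobalDrift V δ B) (hV : Measurable V) (hV0 : ∀ x, 0 ≤ V x)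
    (hδ : 0 ≤ δ) {f : X → ℝ} (hf : Measurable f) (hfv : ∀ x, |f x| ≤ Real.exp (V x))
    (k m : ℕ) {η : Measure X} (hη : integralExp V η < ∞) : Integrable (F.back f k m) η :=
  integrable_of_abs_le_exp hV hη (F.measurable_back hf k m) (h.abs_back_le hV hV0 hδ hf hfv k m)

lemma abs_back_le_back_exp (h : F.GlobalDrift V δ B) (hV : Measurable V) (hV0 : ∀ x, 0 ≤ V x)
    (hδ : 0 ≤ δ) {f : X → ℝ} (hf : Measurable f) (hfv : ∀ x, |f x| ≤ Real.exp (V x))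
    (k m : ℕ) (x : X) : |F.back f k m x| ≤ F.back (fun y => Real.exp (V y)) k m x := by
  induction m generalizing k x with
  | zero => exact hfv x
  | succ m ih =>
    rw [back_succ, back_succ]
    refine abs_integral_le_integral_abs.trans (integral_mono ?_ ?_ (ih (k + 1)))
    · exact (h.integrable_back hV hV0 hδ hf hfv _ _ (h.integralExp_lt_top k x)).abs
    · exact h.integrable_back hV hV0 hδ (Real.measurable_exp.comp hV) (by simp) _ _
        (h.integralExp_lt_top k x)

lemma integralExp_gamma_lt_top (h : F.GlobalDrift V δ B) (hV : Measurable V)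
    (hV0 : ∀ x, 0 ≤ V x) (hδ : 0 ≤ δ) {μ : Measure X} (hμ : integralExp V μ < ∞) (n : ℕ) :
    integralExp V (F.gamma μ n) < ∞ := by
  induction n with
  | zero => simpa [gamma_zero] using hμ
  | succ n ih =>
    rw [gamma_succ, integralExp, Measure.lintegral_bind (F.Q n).aemeasurable (by fun_prop)]
    calc ∫⁻ x, integralExp V (F.Q n x) ∂F.gamma μ n
        ≤ ∫⁻ x, ENNReal.ofReal (Real.exp B) * ENNReal.ofReal (Real.exp (V x)) ∂F.gamma μ n := by
          gcongr with x
          rw [← ofReal_integral_exp hV (h.integralExp_lt_top n x),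
            ← ENNReal.ofReal_mul (by positivity)]
          exact ENNReal.ofReal_le_ofReal (h.integral_exp_le' hV hV0 hδ n x)
      _ = ENNReal.ofReal (Real.exp B) * integralExp V (F.gamma μ n) :=
          lintegral_const_mul _ (by fun_prop)
      _ < ∞ := ENNReal.mul_lt_top ENNReal.ofReal_lt_top ih

lemma integral_gamma_succ (h : F.GlobalDrift V δ B) (hV : Measurable V)
    (hV0 : ∀ x, 0 ≤ V x) (hδ : 0 ≤ δ) {μ : Measure X} (hμ : integralExp V μ < ∞) (n : ℕ)
    {f : X → ℝ} (hf : Measurable f) {K : ℝ} (hK : ∀ x, |f x| ≤ K * Real.exp (V x)) :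
    ∫ x, f x ∂F.gamma μ (n + 1) = ∫ x, ∫ y, f y ∂F.Q n x ∂F.gamma μ n := by
  have hint := integrable_of_abs_le_exp hV (h.integralExp_gamma_lt_top hV hV0 hδ hμ (n + 1)) hf hK
  rw [gamma_succ] at hint ⊢
  rw [Measure.comp_eq_comp_const_apply] at hint ⊢
  rw [Kernel.integral_comp hint, Kernel.const_apply]

lemma integral_back_gamma (h : F.GlobalDrift V δ B) (hV : Measurable V)
    (hV0 : ∀ x, 0 ≤ V x) (hδ : 0 ≤ δ) {μ : Measure X} (hμ : integralExp V μ < ∞)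
    {f : X → ℝ} (hf : Measurable f) (hfv : ∀ x, |f x| ≤ Real.exp (V x)) (k m : ℕ) :
    ∫ x, F.back f k m x ∂F.gamma μ k = ∫ x, f x ∂F.gamma μ (k + m) := by
  induction m generalizing k with
  | zero => rfl
  | succ m ih =>
    rw [show k + (m + 1) = k + 1 + m by ring, ← ih (k + 1),
      h.integral_gamma_succ hV hV0 hδ hμ k (F.measurable_back hf _ _)
        (h.abs_back_le hV hV0 hδ hf hfv _ _)]
    rfl

lemma integral_back_zero (h : F.GlobalDrift V δ B) (hV : Measurable V)
    (hV0 : ∀ x, 0 ≤ V x) (hδ : 0 ≤ δ) {μ : Measure X} (hμ : integralExp V μ < ∞)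
    {f : X → ℝ} (hf : Measurable f) (hfv : ∀ x, |f x| ≤ Real.exp (V x)) (n : ℕ) :
    ∫ x, F.back f 0 n x ∂μ = ∫ x, f x ∂F.gamma μ n := by
  simpa [gamma_zero] using h.integral_back_gamma hV hV0 hδ hμ hf hfv 0 n

end GlobalDrift

end FeynmanKac

/-! ### The coupling bound for pairs. -/

namespace FeynmanKac

variable {X : Type*} [MeasurableSpace X]

/-- Two-sided comparison of all `Q_n(x, ·)`, `x ∈ C`, with `ν` on the set `C`. -/
def LocallyComparable (F : FeynmanKac X) (C : Set X) (e₁ e₂ : ℝ) (ν : Measure X) : Prop :=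
  ∀ n, ∀ x ∈ C, ENNReal.ofReal e₁ • ν.restrict C ≤ (F.Q n x).restrict C ∧
    (F.Q n x).restrict C ≤ ENNReal.ofReal e₂ • ν.restrict C

/-- The antisymmetric function
`(x, y) ↦ Q_{k,k+m} f (x) Q_{k,k+m} 1 (y) - Q_{k,k+m} 1 (x) Q_{k,k+m} f (y)`. -/
noncomputable def pairDiff (F : FeynmanKac X) (f : X → ℝ) (k m : ℕ) (z : X × X) : ℝ :=
  F.back f k m z.1 * F.back (fun _ => 1) k m z.2 - F.back (fun _ => 1) k m z.1 * F.back f k m z.2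

lemma pairDiff_swap (F : FeynmanKac X) (f : X → ℝ) (k m : ℕ) (z : X × X) :
    F.pairDiff f k m z.swap = -F.pairDiff f k m z := by
  simp only [pairDiff, Prod.fst_swap, Prod.snd_swap]
  ring

namespace GlobalDrift

variable {F : FeynmanKac X} {V : X → ℝ} {δ B : ℝ}

lemma integrable_pairDiff (h : F.GlobalDrift V δ B) (hV : Measurable V) (hV0 : ∀ x, 0 ≤ V x)
    (hδ : 0 ≤ δ) {f : X → ℝ} (hf : Measurable f) (hfv : ∀ x, |f x| ≤ Real.exp (V x)) (k m : ℕ)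
    {η η' : Measure X} [SFinite η] [SFinite η'] (hη : integralExp V η < ∞)
    (hη' : integralExp V η' < ∞) : Integrable (F.pairDiff f k m) (η.prod η') := by
  have h1 : ∀ x, |(fun _ : X => (1 : ℝ)) x| ≤ Real.exp (V x) := by simpa using hV0
  exact ((h.integrable_back hV hV0 hδ hf hfv k m hη).mul_prod
    (h.integrable_back hV hV0 hδ measurable_const h1 k m hη')).sub
    ((h.integrable_back hV hV0 hδ measurable_const h1 k m hη).mul_prod
    (h.integrable_back hV hV0 hδ hf hfv k m hη'))

lemma integral_pairDiff (h : F.GlobalDrift V δ B) (hV : Measurable V) (hV0 : ∀ x, 0 ≤ V x)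
    (hδ : 0 ≤ δ) {f : X → ℝ} (hf : Measurable f) (hfv : ∀ x, |f x| ≤ Real.exp (V x)) (k m : ℕ)
    {η η' : Measure X} [SFinite η] [SFinite η'] (hη : integralExp V η < ∞)
    (hη' : integralExp V η' < ∞) :
    ∫ z, F.pairDiff f k m z ∂η.prod η' =
      (∫ x, F.back f k m x ∂η) * (∫ y, F.back (fun _ => 1) k m y ∂η') -
      (∫ x, F.back (fun _ => 1) k m x ∂η) * (∫ y, F.back f k m y ∂η') := by
  have h1 : ∀ x, |(fun _ : X => (1 : ℝ)) x| ≤ Real.exp (V x) := by simpa using hV0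
  rw [← integral_prod_mul, ← integral_prod_mul, ← integral_sub]
  · rfl
  · exact (h.integrable_back hV hV0 hδ hf hfv k m hη).mul_prod
      (h.integrable_back hV hV0 hδ measurable_const h1 k m hη')
  · exact (h.integrable_back hV hV0 hδ measurable_const h1 k m hη).mul_prod
      (h.integrable_back hV hV0 hδ hf hfv k m hη')

/-- Fubini turns each product of integrals into an integral over the pair. The integrand is again
antisymmetric, so the local cancellation is available at every step. -/
lemma pairDiff_succ (h : F.GlobalDrift V δ B) (hV : Measurable V) (hV0 : ∀ x, 0 ≤ V x)
    (hδ : 0 ≤ δ) {f : X → ℝ} (hf : Measurable f) (hfv : ∀ x, |f x| ≤ Real.exp (V x)) (k m : ℕ)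
    (x y : X) :
    F.pairDiff f k (m + 1) (x, y) =
      ∫ z, F.pairDiff f (k + 1) m z ∂(F.Q k x).prod (F.Q k y) := by
  rw [h.integral_pairDiff hV hV0 hδ hf hfv (k + 1) m (h.integralExp_lt_top k x)
    (h.integralExp_lt_top k y)]
  rfl

lemma abs_pairDiff_le (h : F.GlobalDrift V δ B) (hV : Measurable V) (hV0 : ∀ x, 0 ≤ V x)
    (hδ : 0 ≤ δ) {f : X → ℝ} (hf : Measurable f) (hfv : ∀ x, |f x| ≤ Real.exp (V x)) (k m : ℕ)
    (z : X × X) :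
    |F.pairDiff f k m z| ≤ 2 * (F.back (fun y => Real.exp (V y)) k m z.1 *
      F.back (fun y => Real.exp (V y)) k m z.2) := by
  have h1 : ∀ x, |(fun _ : X => (1 : ℝ)) x| ≤ Real.exp (V x) := by simpa using hV0
  have hF := h.abs_back_le_back_exp hV hV0 hδ hf hfv k m
  have hO := h.abs_back_le_back_exp hV hV0 hδ measurable_const h1 k m
  refine (abs_sub _ _).trans ?_
  rw [abs_mul, abs_mul, two_mul]
  refine add_le_add ?_ ?_
  · exact mul_le_mul (hF _) (hO _) (abs_nonneg _) ((abs_nonneg _).trans (hF _))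
  · exact mul_le_mul (hO _) (hF _) (abs_nonneg _) ((abs_nonneg _).trans (hO _))

lemma back_exp_nonneg (V : X → ℝ) (F : FeynmanKac X) (k m : ℕ) (x : X) :
    0 ≤ F.back (fun y => Real.exp (V y)) k m x := by
  induction m generalizing k x with
  | zero => exact (Real.exp_pos _).le
  | succ m ih => exact integral_nonneg (ih (k + 1))

lemma abs_back_exp_le_mul (h : F.GlobalDrift V δ B) (hV : Measurable V) (hV0 : ∀ x, 0 ≤ V x)
    (hδ : 0 ≤ δ) (k m : ℕ) (x y : X) :
    F.back (fun y => Real.exp (V y)) k m x * F.back (fun y => Real.exp (V y)) k m y ≤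
      Real.exp (2 * B) ^ m * (Real.exp (V x) * Real.exp (V y)) := by
  have hb := h.abs_back_le hV hV0 hδ (Real.measurable_exp.comp hV) (by simp) k m
  calc _ ≤ (Real.exp B ^ m * Real.exp (V x)) * (Real.exp B ^ m * Real.exp (V y)) :=
        mul_le_mul ((le_abs_self _).trans (hb x)) ((le_abs_self _).trans (hb y))
          (back_exp_nonneg V F k m y) (by positivity)
    _ = _ := by
        rw [two_mul, Real.exp_add]
        ring

/-- Outside `C_d × C_d` the product kernel contracts `v ⊗ v` by the additional factor `e^{-δd}`. -/
lemma integral_exp_mul_le (h : F.GlobalDrift V δ B) (hV : Measurable V) (hV0 : ∀ x, 0 ≤ V x)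
    (hδ : 0 ≤ δ) (n : ℕ) (x y : X) :
    (∫ a, Real.exp (V a) ∂F.Q n x) * (∫ b, Real.exp (V b) ∂F.Q n y) ≤
        Real.exp (2 * B) * (Real.exp (V x) * Real.exp (V y)) ∧
      ∀ d, (x, y) ∉ sublevel V d ×ˢ sublevel V d →
        (∫ a, Real.exp (V a) ∂F.Q n x) * (∫ b, Real.exp (V b) ∂F.Q n y) ≤
          Real.exp (2 * B) * (Real.exp (-(δ * d)) * (Real.exp (V x) * Real.exp (V y))) := by
  have key : (∫ a, Real.exp (V a) ∂F.Q n x) * (∫ b, Real.exp (V b) ∂F.Q n y) ≤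
      Real.exp (V x * (1 - δ) + B) * Real.exp (V y * (1 - δ) + B) :=
    mul_le_mul (h.integral_exp_le hV n x) (h.integral_exp_le hV n y)
      (integral_nonneg fun b => (Real.exp_pos _).le) (by positivity)
  have hx := mul_nonneg hδ (hV0 x)
  have hy := mul_nonneg hδ (hV0 y)
  refine ⟨key.trans ?_, fun d hd => key.trans ?_⟩
  · simp only [← Real.exp_add]
    exact Real.exp_le_exp.2 (by linarith)
  · simp only [← Real.exp_add]
    refine Real.exp_le_exp.2 ?_
    simp only [Set.mem_prod, sublevel, Set.mem_ofPred_eq, not_and_or, not_le] at hd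
    have : δ * d ≤ δ * (V x + V y) := by
      refine mul_le_mul_of_nonneg_left ?_ hδ
      rcases hd with hd | hd
      · linarith [hV0 y]
      · linarith [hV0 x]
    linarith

/-- The coupling bound. Each step between two pairs in `C_d × C_d` gains a factor `w`; if there are at most
`J` visits to the complement, there are at least `m - 1 - 2J` such steps, and otherwise the visits to the
complement gain `θ ^ J` from the drift. -/
theorem abs_pairDiff_le_pow (h : F.GlobalDrift V δ B) (hV : Measurable V) (hV0 : ∀ x, 0 ≤ V x)
    (hδ : 0 ≤ δ) {d e₁ e₂ w : ℝ} {ν : Measure X} [IsFiniteMeasure ν] (he₁ : 0 < e₁)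
    (he : e₁ ≤ e₂) (hw : 1 - (e₁ / e₂) ^ 2 ≤ w) (hw0 : 0 ≤ w) (hw1 : w ≤ 1)
    (hC : F.LocallyComparable (sublevel V d) e₁ e₂ ν)
    {f : X → ℝ} (hf : Measurable f) (hfv : ∀ x, |f x| ≤ Real.exp (V x)) (m k J : ℕ) (z : X × X) :
    |F.pairDiff f k m z| ≤ 2 * (w ^ (m - 1 - 2 * J) *
        (F.back (fun y => Real.exp (V y)) k m z.1 * F.back (fun y => Real.exp (V y)) k m z.2) +
        Real.exp (-(δ * d)) ^ J * Real.exp (2 * B) ^ m *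
          (Real.exp (V z.1) * Real.exp (V z.2))) ∧
      (z ∉ sublevel V d ×ˢ sublevel V d → |F.pairDiff f k m z| ≤ 2 * (w ^ (m - 2 * J) *
        (F.back (fun y => Real.exp (V y)) k m z.1 * F.back (fun y => Real.exp (V y)) k m z.2) +
        Real.exp (-(δ * d)) ^ J * Real.exp (2 * B) ^ m *
          (Real.exp (V z.1) * Real.exp (V z.2)))) := by
  set v : X → ℝ := fun y => Real.exp (V y) with hv
  set θ := Real.exp (-(δ * d)) with hθ
  set E := Real.exp (2 * B) with hE
  have hθ0 : 0 < θ := Real.exp_pos _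
  have hE0 : 0 < E := Real.exp_pos _
  have hvm : Measurable v := Real.measurable_exp.comp hV
  have hu0 : ∀ k m x, 0 ≤ F.back v k m x := back_exp_nonneg V F
  have hCm : MeasurableSet (sublevel V d) := measurableSet_le hV measurable_const
  have hmono : ∀ {i j : ℕ} {a b : ℝ}, i ≤ j → 0 ≤ a → 2 * (w ^ j * a + b) ≤ 2 * (w ^ i * a + b) := by
    intro i j a b hij ha
    have := mul_le_mul_of_nonneg_right (pow_le_pow_of_le_one hw0 hw1 hij) ha
    linarith
  -- The two clauses are proved together. A step from `C_d × C_d` to its complement gains no `w`, so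
  -- the clause for starting points outside must carry one more power of `w`.
  induction m generalizing k J z with
  | zero =>
    have hb := h.abs_pairDiff_le hV hV0 hδ hf hfv k 0 z
    have : 0 ≤ θ ^ J * E ^ 0 * (Real.exp (V z.1) * Real.exp (V z.2)) := by positivity
    simp only [Nat.zero_sub, pow_zero, one_mul, mul_one] at this ⊢
    exact ⟨by linarith, fun _ => by linarith⟩
  | succ m ih =>
    obtain ⟨x, y⟩ := z
    have hab : ∀ e J' : ℕ, Integrable (fun z : X × X => 2 * (w ^ e *
        (F.back v (k + 1) m z.1 * F.back v (k + 1) m z.2) + θ ^ J' * E ^ m * (v z.1 * v z.2)))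
        ((F.Q k x).prod (F.Q k y)) := by
      intro e J'
      refine ((Integrable.const_mul ?_ _).add (Integrable.const_mul ?_ _)).const_mul _
      · exact (h.integrable_back hV hV0 hδ hvm (by simp [hv]) _ _
          (h.integralExp_lt_top k x)).mul_prod (h.integrable_back hV hV0 hδ hvm (by simp [hv]) _ _
          (h.integralExp_lt_top k y))
      · exact (integrable_exp hV (h.integralExp_lt_top k x)).mul_prod
          (integrable_exp hV (h.integralExp_lt_top k y))
    have hint : ∀ e J' : ℕ, ∫ z, 2 * (w ^ e * (F.back v (k + 1) m z.1 * F.back v (k + 1) m z.2) +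
        θ ^ J' * E ^ m * (v z.1 * v z.2)) ∂(F.Q k x).prod (F.Q k y) =
        2 * (w ^ e * (F.back v k (m + 1) x * F.back v k (m + 1) y) + θ ^ J' * E ^ m *
          ((∫ a, v a ∂F.Q k x) * ∫ b, v b ∂F.Q k y)) := by
      intro e J'
      rw [integral_const_mul, integral_add, integral_const_mul, integral_const_mul,
        integral_prod_mul, integral_prod_mul]
      · rfl
      · refine Integrable.const_mul ?_ _
        exact (h.integrable_back hV hV0 hδ hvm (by simp [hv]) _ _
          (h.integralExp_lt_top k x)).mul_prod (h.integrable_back hV hV0 hδ hvm (by simp [hv]) _ _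
          (h.integralExp_lt_top k y))
      · refine Integrable.const_mul ?_ _
        exact (integrable_exp hV (h.integralExp_lt_top k x)).mul_prod
          (integrable_exp hV (h.integralExp_lt_top k y))
    have hD := h.integrable_pairDiff hV hV0 hδ hf hfv (k + 1) m (h.integralExp_lt_top k x)
      (h.integralExp_lt_top k y)
    have hsucc := h.pairDiff_succ hV hV0 hδ hf hfv k m x y
    obtain ⟨hvv, hvvout⟩ := h.integral_exp_mul_le hV hV0 hδ k x y
    have huu : 0 ≤ F.back v k (m + 1) x * F.back v k (m + 1) y := mul_nonneg (hu0 _ _ _) (hu0 _ _ _)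
    have hout : (x, y) ∉ sublevel V d ×ˢ sublevel V d → |F.pairDiff f k (m + 1) (x, y)| ≤
        2 * (w ^ (m + 1 - 2 * J) * (F.back v k (m + 1) x * F.back v k (m + 1) y) +
          θ ^ J * E ^ (m + 1) * (v x * v y)) := by
      intro hz
      cases J with
      -- With `J = 0` no gain is claimed in the second term, which alone dominates the crude bound.
      | zero =>
        have h1 := h.abs_pairDiff_le hV hV0 hδ hf hfv k (m + 1) (x, y)
        have h2 := h.abs_back_exp_le_mul hV hV0 hδ k (m + 1) x y
        have h3 : 0 ≤ w ^ (m + 1 - 2 * 0) * (F.back v k (m + 1) x * F.back v k (m + 1) y) := by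
          positivity
        rw [pow_zero, one_mul]
        simp only at h1
        linarith
      | succ J =>
        rw [hsucc]
        calc |∫ z, F.pairDiff f (k + 1) m z ∂(F.Q k x).prod (F.Q k y)|
            ≤ ∫ z, |F.pairDiff f (k + 1) m z| ∂(F.Q k x).prod (F.Q k y) :=
              abs_integral_le_integral_abs
          _ ≤ _ := integral_mono hD.abs (hab (m - 1 - 2 * J) J) fun z => (ih (k + 1) J z).1
          _ = _ := hint _ _
          _ ≤ _ := hmono (i := m + 1 - 2 * (J + 1)) (by omega) huu
          -- This visit outside pays for passing from `θ ^ J` to `θ ^ (J + 1)`; two powers of `w`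
          -- are given up in exchange.
          _ ≤ _ := by
              have h4 := mul_le_mul_of_nonneg_left (hvvout d hz)
                (show 0 ≤ θ ^ J * E ^ m by positivity)
              have h5 : θ ^ J * E ^ m * (E * (θ * (v x * v y))) =
                θ ^ (J + 1) * E ^ (m + 1) * (v x * v y) := by ring
              simp only [hv] at h4 h5 ⊢
              linarith
    refine ⟨?_, hout⟩
    by_cases hz : (x, y) ∈ sublevel V d ×ˢ sublevel V d
    · obtain ⟨hx, hy⟩ := hC k x hz.1, hC k y hz.2
      rw [hsucc]
      -- The majorant has exponent `m - 2 * J`. Inside, this is the exponent of the first clause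
      -- plus the `w` just gained; outside, it is that of the second clause.
      refine (abs_integral_prod_le_of_local hCm he₁ he hw hx.1 hx.2 hy.1 hy.2 hD
        (hab (m - 2 * J) J) (F.pairDiff_swap f (k + 1) m) (fun z _ => ?_)
        fun z hz' => (ih (k + 1) J z).2 hz').trans ?_
      · have hz0 : 0 ≤ F.back v (k + 1) m z.1 * F.back v (k + 1) m z.2 :=
          mul_nonneg (hu0 _ _ _) (hu0 _ _ _)
        have hp : 0 ≤ θ ^ J * E ^ m * (v z.1 * v z.2) := by positivity
        calc w * |F.pairDiff f (k + 1) m z|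
            ≤ w * (2 * (w ^ (m - 1 - 2 * J) * (F.back v (k + 1) m z.1 * F.back v (k + 1) m z.2) +
              θ ^ J * E ^ m * (v z.1 * v z.2))) :=
              mul_le_mul_of_nonneg_left (ih (k + 1) J z).1 hw0
          _ = 2 * (w ^ (m - 1 - 2 * J + 1) * (F.back v (k + 1) m z.1 * F.back v (k + 1) m z.2) +
              w * (θ ^ J * E ^ m * (v z.1 * v z.2))) := by ring
          _ ≤ 2 * (w ^ (m - 1 - 2 * J + 1) * (F.back v (k + 1) m z.1 * F.back v (k + 1) m z.2) +
              θ ^ J * E ^ m * (v z.1 * v z.2)) := by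
              have := mul_le_of_le_one_left hp hw1
              linarith
          _ ≤ _ := hmono (by omega) hz0
      · rw [hint]
        have h4 := mul_le_mul_of_nonneg_left hvv (show 0 ≤ θ ^ J * E ^ m by positivity)
        have h5 : θ ^ J * E ^ m * (E * (v x * v y)) = θ ^ J * E ^ (m + 1) * (v x * v y) := by ring
        rw [show m + 1 - 1 - 2 * J = m - 2 * J by omega]
        simp only [hv] at h4 h5 ⊢
        linarith
    · exact (hout hz).trans (hmono (by omega) huu)

end GlobalDrift

end FeynmanKac

/-! ### Moment and mass bounds along the flow. -/

lemma measurableSet_sublevel {X : Type*} [MeasurableSpace X] {V : X → ℝ} (hV : Measurable V)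
    (d : ℝ) : MeasurableSet (sublevel V d) :=
  measurableSet_le hV measurable_const

lemma isFiniteMeasure_of_integralExp_lt_top {X : Type*} [MeasurableSpace X] {V : X → ℝ}
    (hV0 : ∀ x, 0 ≤ V x) {η : Measure X} (h : integralExp V η < ∞) : IsFiniteMeasure η := by
  refine ⟨lt_of_le_of_lt ?_ h⟩
  rw [← lintegral_one, integralExp]
  gcongr with x
  simpa using hV0 x

lemma exists_measure_sublevel_pos {X : Type*} [MeasurableSpace X] (V : X → ℝ) (η : Measure X)
    [NeZero η] (r : ℝ) : ∃ d, r ≤ d ∧ 0 < η (sublevel V d) := by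
  by_contra! hcon
  have h : η (⋃ n : ℕ, sublevel V (r + n)) = 0 := by
    rw [measure_iUnion_null_iff]
    intro n
    exact le_antisymm (hcon (r + n) (by simp)) zero_le
  have huniv : (⋃ n : ℕ, sublevel V (r + n)) = Set.univ := by
    refine Set.eq_univ_of_forall fun x => Set.mem_iUnion.2 ?_
    obtain ⟨n, hn⟩ := exists_nat_ge (V x - r)
    exact ⟨n, show V x ≤ r + n by linarith⟩
  rw [huniv] at h
  exact NeZero.ne η (Measure.measure_univ_eq_zero.1 h)

lemma exists_ge_exp_neg_mul_le {δ : ℝ} (hδ : 0 < δ) (r : ℝ) {a : ℝ} (ha : 0 < a) :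
    ∃ d₀, r ≤ d₀ ∧ ∀ d, d₀ ≤ d → Real.exp (-(δ * d)) ≤ a := by
  refine ⟨max r (-Real.log a / δ), le_max_left _ _, fun d hd => ?_⟩
  have h1 : -Real.log a ≤ δ * d := by
    rw [mul_comm]; exact (div_le_iff₀ hδ).1 ((le_max_right _ _).trans hd)
  calc Real.exp (-(δ * d)) ≤ Real.exp (Real.log a) := Real.exp_le_exp.2 (by linarith)
    _ = a := Real.exp_log ha

section

variable {X : Type*} [MeasurableSpace X] {F : FeynmanKac X} {V : X → ℝ} {δ dlow : ℝ}
  {b εm εp : ℝ → ℝ} {ν : ℝ → Measure X}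

/-- The indicator term is bounded by the positive part of `b dlow`; the maximum with `0` covers
points outside the sublevel set and a negative `b dlow`. -/
lemma DriftCondition.globalDrift (h : DriftCondition F V δ dlow b) :
    F.GlobalDrift V δ (max (b dlow) 0) := by
  intro n x
  refine (h.drift dlow le_rfl n x).trans (ENNReal.ofReal_le_ofReal (Real.exp_le_exp.2 ?_))
  gcongr
  exact Set.indicator_apply_le' (fun _ => le_max_left _ _) fun _ => le_max_right _ _

lemma MinorizationCondition.locallyComparable
    (h : MinorizationCondition F V dlow εm ν) (h' : MajorizationCondition F V dlow εm εp ν)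
    {d : ℝ} (hd : dlow ≤ d) : F.LocallyComparable (sublevel V d) (εm d) (εp d) (ν d) := by
  intro n x hx
  constructor <;> refine Measure.le_iff.2 fun A hA => ?_
  · rw [Measure.smul_apply, Measure.restrict_apply hA, Measure.restrict_apply hA, Set.inter_comm]
    exact h.minorization d hd n x hx A hA
  · rw [Measure.smul_apply, Measure.restrict_apply hA, Measure.restrict_apply hA, Set.inter_comm]
    exact h'.majorization d hd n x hx A hA

/-- The minorization on `C_d` is tested on `C_r ⊆ C_d`. With `d = r = dlow` it yields geometric
growth or decay of mass; with larger `d` it shows that mass in `C_d` feeds the smaller set in one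
step. -/
lemma MinorizationCondition.le_gamma_succ (hV : Measurable V)
    (h : MinorizationCondition F V dlow εm ν) (μ : Measure X) {d r : ℝ} (hd : dlow ≤ d)
    (hr : r ≤ d) (n : ℕ) :
    ENNReal.ofReal (εm d) * ν d (sublevel V r) * F.gamma μ n (sublevel V d) ≤
      F.gamma μ (n + 1) (sublevel V r) := by
  have hsub : sublevel V d ∩ sublevel V r = sublevel V r :=
    Set.inter_eq_right.2 fun x (hx : V x ≤ r) => hx.trans hr
  have hrm := measurableSet_sublevel hV r
  rw [FeynmanKac.gamma_succ, Measure.bind_apply hrm (F.Q n).aemeasurable,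
    ← setLIntegral_const]
  refine (setLIntegral_mono ((F.Q n).measurable_coe hrm) fun x hx => ?_).trans
    (setLIntegral_le_lintegral _ _)
  simpa only [hsub] using h.minorization d hd n x hx _ hrm

lemma MinorizationCondition.le_gamma_succ_real (hV : Measurable V)
    (h : MinorizationCondition F V dlow εm ν) (μ : Measure X) {d r : ℝ} (hd : dlow ≤ d)
    (hr : r ≤ d) (n : ℕ) [IsFiniteMeasure (F.gamma μ (n + 1))] :
    εm d * (ν d).real (sublevel V r) * (F.gamma μ n).real (sublevel V d) ≤
      (F.gamma μ (n + 1)).real (sublevel V r) := by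
  have := ENNReal.toReal_mono (measure_ne_top _ _) (h.le_gamma_succ hV μ hd hr n)
  rwa [ENNReal.toReal_mul, ENNReal.toReal_mul,
    ENNReal.toReal_ofReal (h.eps_pos d hd).le] at this

/-- The one constant `B` gives a localised drift at every level: off `C_d` the factor `e^{-δV}` is
at most `e^{-δd}`, and on `C_d` the bound is at most `e^{B+d}`. -/
lemma FeynmanKac.GlobalDrift.integral_exp_gamma_succ_le {B : ℝ} (h : F.GlobalDrift V δ B)
    (hV : Measurable V) (hV0 : ∀ x, 0 ≤ V x) (hδ : 0 ≤ δ) {μ : Measure X}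
    (hμ : integralExp V μ < ∞) (d : ℝ) (n : ℕ) :
    ∫ x, Real.exp (V x) ∂F.gamma μ (n + 1) ≤
      Real.exp B * Real.exp (-(δ * d)) * ∫ x, Real.exp (V x) ∂F.gamma μ n +
        Real.exp (B + d) * (F.gamma μ n).real (sublevel V d) := by
  have hfin := h.integralExp_gamma_lt_top hV hV0 hδ hμ n
  have := isFiniteMeasure_of_integralExp_lt_top hV0 hfin
  have hm := measurableSet_sublevel hV d
  have hv := FeynmanKac.integrable_exp hV hfin
  have hind : Integrable ((sublevel V d).indicator fun _ => Real.exp (B + d)) (F.gamma μ n) :=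
    (integrable_const _).indicator hm
  have hvm : Measurable fun x => Real.exp (V x) := Real.measurable_exp.comp hV
  rw [h.integral_gamma_succ hV hV0 hδ hμ n hvm (K := 1) (by simp)]
  calc ∫ x, ∫ y, Real.exp (V y) ∂F.Q n x ∂F.gamma μ n
      ≤ ∫ x, (Real.exp B * Real.exp (-(δ * d)) * Real.exp (V x) +
          (sublevel V d).indicator (fun _ => Real.exp (B + d)) x) ∂F.gamma μ n := by
        refine integral_mono (h.integrable_back hV hV0 hδ hvm (by simp) n 1 hfin)
          ((hv.const_mul _).add hind) fun x => ?_
        have hx := mul_nonneg hδ (hV0 x)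
        have hQ := h.integral_exp_le hV n x
        by_cases hxd : x ∈ sublevel V d
        · refine hQ.trans ?_
          simp only [Set.indicator_of_mem hxd]
          have h1 : Real.exp (V x * (1 - δ) + B) ≤ Real.exp (B + d) := by
            refine Real.exp_le_exp.2 ?_
            have : V x ≤ d := hxd
            linarith
          have h2 : 0 ≤ Real.exp B * Real.exp (-(δ * d)) * Real.exp (V x) := by positivity
          linarith
        · refine hQ.trans ?_
          simp only [Set.indicator_of_notMem hxd, add_zero, ← Real.exp_add]
          refine Real.exp_le_exp.2 ?_
          have : d ≤ V x := (not_le.1 hxd).le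
          have := mul_le_mul_of_nonneg_left this hδ
          linarith
    _ = _ := by
        rw [integral_add (hv.const_mul _) hind, integral_const_mul, integral_indicator hm,
          setIntegral_const, smul_eq_mul, mul_comm (Real.exp (B + d))]

/-- Uniformly over all admissible models, `η_n(v)` is bounded and the total mass of `γ_n` decays at most
geometrically, at a rate that does not depend on the initial law. -/
lemma exists_gamma_bounds (hV : Measurable V) (hV1 : ∀ x, 1 ≤ V x) (hδ : 0 < δ)
    (hε : ∀ d, dlow ≤ d → 0 < εm d) (hν : ∀ d, dlow ≤ d → MemP V (ν d))
    (hpos : ∀ d, dlow ≤ d → ∀ r, dlow ≤ r → r ≤ d → 0 < ν d (sublevel V r))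
    {μ : Measure X} (hμ : MemP V μ) (B : ℝ) :
    ∃ C c : ℝ, 0 < C ∧ 0 < c ∧ ∀ F : FeynmanKac X, F.GlobalDrift V δ B →
      MinorizationCondition F V dlow εm ν → ∀ n,
        ∫ x, Real.exp (V x) ∂F.gamma μ n ≤ C * (F.gamma μ n).real Set.univ ∧
        c * (εm dlow * (ν dlow).real (sublevel V dlow)) ^ n ≤ (F.gamma μ n).real Set.univ := by
  have hV0 : ∀ x, 0 ≤ V x := fun x => zero_le_one.trans (hV1 x)
  have := hμ.1
  have hposr : ∀ d, dlow ≤ d → 0 < εm d * (ν d).real (sublevel V dlow) := fun d hd => by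
    have := (hν d hd).1
    exact mul_pos (hε d hd) (ENNReal.toReal_pos (hpos d hd dlow le_rfl hd).ne' (measure_ne_top _ _))
  set l := εm dlow * (ν dlow).real (sublevel V dlow) with hl
  have hl0 : 0 < l := hposr dlow le_rfl
  -- This `d` makes the contraction of `γ_n(v)` at least twice as fast as the guaranteed rate `l`
  -- for the mass of `C_dlow`.
  obtain ⟨d, hd, hdexp⟩ := exists_ge_exp_neg_mul_le hδ dlow
    (show 0 < l / 2 / Real.exp B by positivity)
  have hθ : Real.exp B * Real.exp (-(δ * d)) ≤ l / 2 := by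
    have := hdexp d le_rfl
    rwa [le_div_iff₀ (Real.exp_pos _), mul_comm] at this
  -- `μ` need not charge `C_dlow`, but it charges some `C_r`, from which `C_dlow` is reached in one
  -- step. Hence the induction below starts at time `1`.
  obtain ⟨r, hr, hμr⟩ := exists_measure_sublevel_pos V μ dlow
  set c' := εm d * (ν d).real (sublevel V dlow) with hc'
  have hc'0 : 0 < c' := hposr d hd
  set m := εm r * (ν r).real (sublevel V dlow) * μ.real (sublevel V r) with hm
  have hm0 : 0 < m := mul_pos (hposr r hr) (ENNReal.toReal_pos hμr.ne' (measure_ne_top _ _))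
  set A := ∫ x, Real.exp (V x) ∂μ with hA
  have hA0 : 0 < A := by
    have hvint := FeynmanKac.integrable_exp hV hμ.2
    have : (1 : ℝ) ≤ A := by
      calc (1 : ℝ) = ∫ _, (1 : ℝ) ∂μ := by simp
        _ ≤ A := integral_mono (integrable_const _) hvint fun x => by simpa using hV0 x
    linarith
  set K := Real.exp (B + d) with hK
  have hK0 : 0 < K := Real.exp_pos _
  -- The three summands serve time `0`, time `1` and the induction step; in the minimum, `1` serves
  -- time `0` and `m / l` the later times.
  refine ⟨A + Real.exp B * A / m + 2 * K / c', min 1 (m / l), by positivity, by positivity, ?_⟩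
  set C := A + Real.exp B * A / m + 2 * K / c' with hC
  have hEA : 0 ≤ Real.exp B * A / m := by positivity
  have hKc : 0 ≤ 2 * K / c' := by positivity
  have hC0 : 0 < C := by positivity
  have hCm : Real.exp B * A ≤ C * m := by
    rw [← div_le_iff₀ hm0]; linarith
  have hCc : 2 * K ≤ C * c' := by
    rw [← div_le_iff₀ hc'0]; linarith
  intro F hF hmin n
  have hfin : ∀ n, IsFiniteMeasure (F.gamma μ n) := fun n =>
    isFiniteMeasure_of_integralExp_lt_top hV0 (hF.integralExp_gamma_lt_top hV hV0 hδ.le hμ.2 n)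
  -- The moment is compared with the mass of `C_dlow` rather than the total mass, since only the
  -- former has a one-step lower bound. In the induction step, the contracted moment and the mass of
  -- `C_d` each contribute at most half of `C`.
  have key : ∀ n, ∫ x, Real.exp (V x) ∂F.gamma μ (n + 1) ≤
      C * (F.gamma μ (n + 1)).real (sublevel V dlow) ∧
      m * l ^ n ≤ (F.gamma μ (n + 1)).real (sublevel V dlow) := by
    intro n
    induction n with
    | zero =>
      have h1 : m ≤ (F.gamma μ (0 + 1)).real (sublevel V dlow) := by
        have := hmin.le_gamma_succ_real hV μ hr hr 0
        rwa [FeynmanKac.gamma_zero] at this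
      refine ⟨?_, by simpa using h1⟩
      calc ∫ x, Real.exp (V x) ∂F.gamma μ (0 + 1)
          = ∫ x, ∫ y, Real.exp (V y) ∂F.Q 0 x ∂μ := by
            rw [hF.integral_gamma_succ hV hV0 hδ.le hμ.2 0 (show Measurable fun x => Real.exp (V x) by fun_prop)
              (K := 1) (by simp), FeynmanKac.gamma_zero]
        _ ≤ ∫ x, Real.exp B * Real.exp (V x) ∂μ :=
            integral_mono (hF.integrable_back hV hV0 hδ.le (Real.measurable_exp.comp hV)
              (by simp) 0 1 hμ.2) ((FeynmanKac.integrable_exp hV hμ.2).const_mul _)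
              (hF.integral_exp_le' hV hV0 hδ.le 0)
        _ = Real.exp B * A := integral_const_mul _ _
        _ ≤ C * m := hCm
        _ ≤ _ := by gcongr
    | succ n ih =>
      have h1 := hmin.le_gamma_succ_real hV μ le_rfl le_rfl (n + 1)
      have h2 := hmin.le_gamma_succ_real hV μ hd hd (n + 1)
      have h3 := hF.integral_exp_gamma_succ_le hV hV0 hδ.le hμ.2 d (n + 1)
      have hv0 : 0 ≤ ∫ x, Real.exp (V x) ∂F.gamma μ (n + 1) :=
        integral_nonneg fun x => (Real.exp_pos _).le
      constructor
      · have h4 := mul_le_mul_of_nonneg_right hθ hv0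
        have h5 := mul_le_mul_of_nonneg_left ih.1 (half_pos hl0).le
        have h6 := mul_le_mul_of_nonneg_left h1 (half_pos hC0).le
        have h7 := mul_le_mul_of_nonneg_left h2 (half_pos hC0).le
        have h8 := mul_le_mul_of_nonneg_right hCc
          (measureReal_nonneg (μ := F.gamma μ (n + 1)) (s := sublevel V d))
        rw [← hl] at h6
        rw [← hc'] at h7
        rw [← hK] at h3
        linarith
      · calc m * l ^ (n + 1) = l * (m * l ^ n) := by ring
          _ ≤ l * (F.gamma μ (n + 1)).real (sublevel V dlow) := by gcongr; exact ih.2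
          _ ≤ _ := h1
  have hmono : ∀ n, (F.gamma μ n).real (sublevel V dlow) ≤ (F.gamma μ n).real Set.univ :=
    fun n => measureReal_mono (Set.subset_univ _)
  cases n with
  | zero =>
    rw [FeynmanKac.gamma_zero, probReal_univ, mul_one, pow_zero, mul_one]
    exact ⟨by linarith, min_le_left _ _⟩
  | succ n =>
    refine ⟨(key n).1.trans (mul_le_mul_of_nonneg_left (hmono _) hC0.le), le_trans ?_ (hmono _)⟩
    calc min 1 (m / l) * l ^ (n + 1) ≤ m / l * l ^ (n + 1) := by gcongr; exact min_le_right _ _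
      _ = m * l ^ n := by
          field_simp
          ring
      _ ≤ _ := (key n).2

end

/-! ### Normalisation and choice of constants. -/

lemma vNorm_toSignedMeasure_sub_le {X : Type*} [MeasurableSpace X] {V : X → ℝ}
    (hV : Measurable V) {η η' : Measure X} [IsFiniteMeasure η] [IsFiniteMeasure η']
    (hη : integralExp V η < ∞) (hη' : integralExp V η' < ∞) {K : ℝ}
    (h : ∀ f : X → ℝ, Measurable f → (∀ x, |f x| ≤ Real.exp (V x)) →
      |∫ x, f x ∂η - ∫ x, f x ∂η'| ≤ K) :
    vNorm V (η.toSignedMeasure - η'.toSignedMeasure) ≤ ENNReal.ofReal K := by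
  refine iSup_le fun f => ENNReal.ofReal_le_ofReal ?_
  have hint : ∀ {ζ : Measure X}, integralExp V ζ < ∞ → Integrable f.1 ζ := fun hζ =>
    FeynmanKac.integrable_of_abs_le_exp hV hζ f.2.1 (K := 1) (by simpa using f.2.2)
  rw [VectorMeasure.integral_sub_vectorMeasure, VectorMeasure.integral_toSignedMeasure,
    VectorMeasure.integral_toSignedMeasure]
  · exact (le_abs_self _).trans (h f.1 f.2.1 f.2.2)
  · rw [VectorMeasure.Integrable, Measure.variation_toSignedMeasure]; exact hint hη
  · rw [VectorMeasure.Integrable, Measure.variation_toSignedMeasure]; exact hint hη'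

namespace FeynmanKac

variable {X : Type*} [MeasurableSpace X] {F : FeynmanKac X} {V : X → ℝ} {δ B : ℝ}

lemma integral_eta (F : FeynmanKac X) (μ : Measure X) (n : ℕ) (f : X → ℝ) :
    ∫ x, f x ∂F.eta μ n = (∫ x, f x ∂F.gamma μ n) / (F.gamma μ n).real Set.univ := by
  rw [eta, integral_smul_measure, ENNReal.toReal_inv, smul_eq_mul, div_eq_inv_mul]
  rfl

lemma GlobalDrift.integralExp_eta_lt_top (h : F.GlobalDrift V δ B) (hV : Measurable V)
    (hV0 : ∀ x, 0 ≤ V x) (hδ : 0 ≤ δ) {μ : Measure X} (hμ : integralExp V μ < ∞) {n : ℕ}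
    (hpos : 0 < (F.gamma μ n).real Set.univ) : integralExp V (F.eta μ n) < ∞ := by
  rw [eta, integralExp, lintegral_smul_measure]
  refine ENNReal.mul_lt_top (ENNReal.inv_lt_top.2 ?_)
    (h.integralExp_gamma_lt_top hV hV0 hδ hμ n)
  exact (ENNReal.toReal_pos_iff.1 hpos).1

/-- Integrating the coupling bound against `μ ⊗ μ'` turns `Qv ⊗ Qv` into `γ_n(v) γ'_n(v)`, whose
quotient by the masses is at most `C C'`. The other term has no such normalisation and needs the
lower bounds `p` and `p'`. -/
lemma GlobalDrift.abs_integral_eta_sub_le (h : F.GlobalDrift V δ B) (hV : Measurable V)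
    (hV0 : ∀ x, 0 ≤ V x) (hδ : 0 ≤ δ) {d e₁ e₂ w : ℝ} {ν : Measure X} [IsFiniteMeasure ν]
    (he₁ : 0 < e₁) (he : e₁ ≤ e₂) (hw : 1 - (e₁ / e₂) ^ 2 ≤ w) (hw0 : 0 ≤ w) (hw1 : w ≤ 1)
    (hC : F.LocallyComparable (sublevel V d) e₁ e₂ ν) {μ μ' : Measure X} (hμ : MemP V μ)
    (hμ' : MemP V μ') {n : ℕ} {C C' p p' : ℝ} (hC0 : 0 ≤ C) (hp0 : 0 < p) (hp0' : 0 < p')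
    (hbd : ∫ x, Real.exp (V x) ∂F.gamma μ n ≤ C * (F.gamma μ n).real Set.univ)
    (hbd' : ∫ x, Real.exp (V x) ∂F.gamma μ' n ≤ C' * (F.gamma μ' n).real Set.univ)
    (hp : p ≤ (F.gamma μ n).real Set.univ) (hp' : p' ≤ (F.gamma μ' n).real Set.univ)
    {f : X → ℝ} (hf : Measurable f) (hfv : ∀ x, |f x| ≤ Real.exp (V x)) (J : ℕ) :
    |∫ x, f x ∂F.eta μ n - ∫ x, f x ∂F.eta μ' n| ≤ 2 * (w ^ (n - 1 - 2 * J) * (C * C') +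
      Real.exp (-(δ * d)) ^ J * Real.exp (2 * B) ^ n *
        ((∫ x, Real.exp (V x) ∂μ) * ∫ x, Real.exp (V x) ∂μ') / (p * p')) := by
  have := hμ.1
  have := hμ'.1
  have hfin := isFiniteMeasure_of_integralExp_lt_top hV0
    (h.integralExp_gamma_lt_top hV hV0 hδ hμ.2 n)
  have hfin' := isFiniteMeasure_of_integralExp_lt_top hV0
    (h.integralExp_gamma_lt_top hV hV0 hδ hμ'.2 n)
  have hvm : Measurable fun x => Real.exp (V x) := Real.measurable_exp.comp hV
  have hvv : ∀ x, |(fun x => Real.exp (V x)) x| ≤ Real.exp (V x) := by simp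
  have h1 : ∀ x, |(fun _ : X => (1 : ℝ)) x| ≤ Real.exp (V x) := by simpa using hV0
  set S := (F.gamma μ n).real Set.univ with hS
  set S' := (F.gamma μ' n).real Set.univ with hS'
  have hSpos : 0 < S := hp0.trans_le hp
  have hSpos' : 0 < S' := hp0'.trans_le hp'
  set A := ∫ x, Real.exp (V x) ∂μ with hA
  set A' := ∫ x, Real.exp (V x) ∂μ' with hA'
  have hA0 : 0 ≤ A := integral_nonneg fun x => (Real.exp_pos _).le
  have hA0' : 0 ≤ A' := integral_nonneg fun x => (Real.exp_pos _).le
  set T := Real.exp (-(δ * d)) ^ J * Real.exp (2 * B) ^ n with hT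
  have hT0 : 0 ≤ T := by positivity
  set a := w ^ (n - 1 - 2 * J) with ha
  have ha0 : 0 ≤ a := by positivity
  have hnum : |(∫ x, f x ∂F.gamma μ n) * S' - S * ∫ x, f x ∂F.gamma μ' n| ≤
      2 * (a * ((C * S) * (C' * S')) + T * (A * A')) := by
    have hone : ∀ {ζ : Measure X}, integralExp V ζ < ∞ →
        ∫ x, F.back (fun _ => 1) 0 n x ∂ζ = (F.gamma ζ n).real Set.univ := fun hζ => by
      rw [h.integral_back_zero hV hV0 hδ hζ measurable_const h1]; simp
    have hD := h.integral_pairDiff hV hV0 hδ hf hfv 0 n hμ.2 hμ'.2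
    rw [h.integral_back_zero hV hV0 hδ hμ.2 hf hfv, h.integral_back_zero hV hV0 hδ hμ'.2 hf hfv,
      hone hμ.2, hone hμ'.2] at hD
    rw [← hD]
    have hi1 := (h.integrable_back hV hV0 hδ hvm hvv 0 n hμ.2).mul_prod
      (h.integrable_back hV hV0 hδ hvm hvv 0 n hμ'.2)
    have hi2 := (integrable_exp hV hμ.2).mul_prod (integrable_exp hV hμ'.2)
    calc |∫ z, F.pairDiff f 0 n z ∂μ.prod μ'| ≤ ∫ z, |F.pairDiff f 0 n z| ∂μ.prod μ' :=
          abs_integral_le_integral_abs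
      _ ≤ ∫ z, 2 * (a * (F.back (fun y => Real.exp (V y)) 0 n z.1 *
            F.back (fun y => Real.exp (V y)) 0 n z.2) +
            T * (Real.exp (V z.1) * Real.exp (V z.2))) ∂μ.prod μ' :=
          integral_mono (h.integrable_pairDiff hV hV0 hδ hf hfv 0 n hμ.2 hμ'.2).abs
            (((hi1.const_mul a).add (hi2.const_mul T)).const_mul 2) fun z =>
            (h.abs_pairDiff_le_pow hV hV0 hδ he₁ he hw hw0 hw1 hC hf hfv n 0 J z).1
      _ = 2 * (a * ((∫ x, Real.exp (V x) ∂F.gamma μ n) * ∫ x, Real.exp (V x) ∂F.gamma μ' n) +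
            T * (A * A')) := by
          rw [integral_const_mul, integral_add (hi1.const_mul a) (hi2.const_mul T),
            integral_const_mul, integral_const_mul, integral_prod_mul,
            integral_prod_mul (fun x => Real.exp (V x)) (fun x => Real.exp (V x)),
            h.integral_back_zero hV hV0 hδ hμ.2 hvm hvv,
            h.integral_back_zero hV hV0 hδ hμ'.2 hvm hvv]
      _ ≤ _ := by
          gcongr
  rw [integral_eta, integral_eta, div_sub_div _ _ hSpos.ne' hSpos'.ne', abs_div,
    abs_of_pos (mul_pos hSpos hSpos'), div_le_iff₀ (mul_pos hSpos hSpos')]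
  refine hnum.trans ?_
  have hfrac : T * (A * A') ≤ T * (A * A') / (p * p') * (S * S') := by
    rw [div_mul_eq_mul_div, le_div_iff₀ (mul_pos hp0 hp0')]
    gcongr
  linarith

end FeynmanKac

lemma one_le_integral_exp {X : Type*} [MeasurableSpace X] {V : X → ℝ} (hV : Measurable V)
    (hV0 : ∀ x, 0 ≤ V x) {μ : Measure X} (hμ : MemP V μ) : 1 ≤ ∫ x, Real.exp (V x) ∂μ := by
  have := hμ.1
  calc (1 : ℝ) = ∫ _, (1 : ℝ) ∂μ := by simp
    _ ≤ _ := integral_mono (integrable_const _) (FeynmanKac.integrable_exp hV hμ.2) fun x => by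
      simpa using hV0 x

/-- Balancing the two error terms of the coupling bound with `J = ⌊n/4⌋`. -/
lemma pow_add_pow_le_of_quarter {w τ E l c c' K A : ℝ} (hw : 1 / 2 ≤ w) (hw1 : w ≤ 1)
    (hτ : 0 < τ) (hτ1 : τ ≤ 1) (hE : 0 < E) (hl : 0 < l) (hτE : τ * (E / l ^ 2) ≤ 1 / 2)
    (hc : 0 < c) (hc' : 0 < c') (hK : 0 ≤ K) (hA : 1 ≤ A) (n : ℕ) :
    2 * (w ^ (n - 1 - 2 * (n / 4)) * K +
      (τ ^ 4) ^ (n / 4) * E ^ n * A / ((c * l ^ n) * (c' * l ^ n))) ≤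
      max √w (1 / 2) ^ n * (4 * K + 2 / (τ ^ 3 * (c * c'))) * A := by
  have hw0 : 0 < w := by linarith
  set s := √w with hs
  have hsw : s ^ 2 = w := Real.sq_sqrt hw0.le
  have hs0 : 0 ≤ s := Real.sqrt_nonneg _
  have hs1 : s ≤ 1 := Real.sqrt_le_one.2 hw1
  set ρ := max s (1 / 2) with hρ
  have hρ0 : 0 ≤ ρ ^ n := pow_nonneg (hs0.trans (le_max_left _ _)) n
  have h1 : w ^ (n - 1 - 2 * (n / 4)) ≤ 2 * ρ ^ n := by
    -- The extra `w` absorbs the `-1` in the exponent, also under truncated subtraction; since `w ≥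
    -- 1/2`, removing it costs a factor `2`.
    have h2 : w ^ (n - 1 - 2 * (n / 4)) * w ≤ ρ ^ n := by
      calc w ^ (n - 1 - 2 * (n / 4)) * w = s ^ (2 * (n - 1 - 2 * (n / 4) + 1)) := by
            rw [pow_mul, hsw, pow_succ]
        _ ≤ s ^ n := pow_le_pow_of_le_one hs0 hs1 (by omega)
        _ ≤ ρ ^ n := pow_le_pow_left₀ hs0 (le_max_left _ _) n
    have h3 := mul_le_mul_of_nonneg_left hw (pow_nonneg hw0.le (n - 1 - 2 * (n / 4)))
    linarith
  have h4 : (τ ^ 4) ^ (n / 4) * E ^ n * A / ((c * l ^ n) * (c' * l ^ n)) ≤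
      ρ ^ n * (1 / (τ ^ 3 * (c * c'))) * A := by
    -- The factor `τ ^ 3` covers the remainder of `n` modulo `4`.
    have h5 : (τ ^ 4) ^ (n / 4) * τ ^ 3 ≤ τ ^ n := by
      rw [← pow_mul, ← pow_add]
      exact pow_le_pow_of_le_one hτ.le hτ1 (by omega)
    have h6 : τ ^ n * (E ^ n / (l ^ n * l ^ n)) ≤ ρ ^ n := by
      calc τ ^ n * (E ^ n / (l ^ n * l ^ n)) = (τ * (E / l ^ 2)) ^ n := by
            rw [mul_pow, div_pow, sq, mul_pow]
        _ ≤ ρ ^ n := pow_le_pow_left₀ (by positivity) (hτE.trans (le_max_right _ _)) n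
    calc (τ ^ 4) ^ (n / 4) * E ^ n * A / ((c * l ^ n) * (c' * l ^ n))
        = ((τ ^ 4) ^ (n / 4) * τ ^ 3) * (E ^ n / (l ^ n * l ^ n)) * (1 / (τ ^ 3 * (c * c'))) * A := by
          field_simp
      _ ≤ τ ^ n * (E ^ n / (l ^ n * l ^ n)) * (1 / (τ ^ 3 * (c * c'))) * A := by gcongr
      _ ≤ _ := by gcongr
  have h7 : w ^ (n - 1 - 2 * (n / 4)) * K ≤ 2 * ρ ^ n * K * A :=
    (mul_le_mul_of_nonneg_right h1 hK).trans (le_mul_of_one_le_right (by positivity) hA)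
  calc _ ≤ 2 * (2 * ρ ^ n * K * A + ρ ^ n * (1 / (τ ^ 3 * (c * c'))) * A) := by gcongr
    _ = _ := by ring

theorem corollary1 {X : Type*} [TopologicalSpace X] [PolishSpace X] [MeasurableSpace X]
    [BorelSpace X] (V : X → ℝ) (δ dlow : ℝ) (b εm εp : ℝ → ℝ) (ν : ℝ → Measure X)
    (μ : Measure X) (hμ : InitialCondition V μ) :
    ∃ ρ : ℝ≥0, ρ < 1 ∧
      ∀ μ' : Measure X, MemP V μ' →
        ∃ c : ℝ≥0, ∀ F : FeynmanKac X,
          DriftCondition F V δ dlow b →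
          MinorizationCondition F V dlow εm ν →
          MajorizationCondition F V dlow εm εp ν →
            ∀ n : ℕ,
              vNorm V ((F.eta μ n).toSignedMeasure - (F.eta μ' n).toSignedMeasure) ≤
                (ρ : ℝ≥0∞) ^ n * c * integralExp V μ * integralExp V μ' := by
  -- The regularity and positivity of the data are recorded in conditions on a model. One admissible
  -- model supplies them; without any, the claim is vacuous.
  by_cases hex : ∃ F : FeynmanKac X, DriftCondition F V δ dlow b ∧
    MinorizationCondition F V dlow εm ν ∧ MajorizationCondition F V dlow εm εp ν
  swap
  · exact ⟨0, zero_lt_one, fun μ' _ => ⟨0, fun F h₁ h₂ h₃ => (hex ⟨F, h₁, h₂, h₃⟩).elim⟩⟩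
  obtain ⟨F₀, hdr, hmin, hmaj⟩ := hex
  have hV := hdr.measurable_V
  have hV0 : ∀ x, 0 ≤ V x := fun x => zero_le_one.trans (hdr.one_le_V x)
  have hδ := hdr.delta_pos
  have hbounds := fun {ζ : Measure X} (hζ : MemP V ζ) => exists_gamma_bounds hV hdr.one_le_V hδ
    hmin.eps_pos hmin.nu_mem hmin.nu_pos hζ (max (b dlow) 0)
  set B := max (b dlow) 0
  set l := εm dlow * (ν dlow).real (sublevel V dlow) with hl
  have hl0 : 0 < l := by
    have := (hmin.nu_mem dlow le_rfl).1
    exact mul_pos (hmin.eps_pos dlow le_rfl) (ENNReal.toReal_pos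
      (hmin.nu_pos dlow le_rfl dlow le_rfl le_rfl).ne' (measure_ne_top _ _))
  set E := Real.exp (2 * B)
  have hE : 0 < E := Real.exp_pos _
  -- The rate `δ / 4` makes `θ = τ ^ 4`, so that `θ ^ (n / 4)` is comparable with `τ ^ n`.
  obtain ⟨d, hd, hdexp⟩ := exists_ge_exp_neg_mul_le (show 0 < δ / 4 by positivity) dlow
    (show 0 < 1 / 2 / (E / l ^ 2) by positivity)
  set τ := Real.exp (-(δ / 4 * d)) with hτ
  have hτ0 : 0 < τ := Real.exp_pos _
  have hτ1 : τ ≤ 1 := by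
    rw [hτ, Real.exp_le_one_iff, neg_nonpos]
    have : 0 ≤ d := zero_le_one.trans (hdr.one_le_dlow.trans hd)
    positivity
  have hτE : τ * (E / l ^ 2) ≤ 1 / 2 := (le_div_iff₀ (by positivity)).1 (hdexp d le_rfl)
  have hτ4 : Real.exp (-(δ * d)) = τ ^ 4 := by
    rw [hτ, ← Real.exp_nat_mul]
    congr 1
    push_cast
    ring
  have he₁ := hmin.eps_pos d hd
  have he := hmaj.eps_le d hd
  have he₂ : 0 < εp d := he₁.trans_le he
  have hκ0 : 0 < (εm d / εp d) ^ 2 := by positivity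
  have hκ1 : (εm d / εp d) ^ 2 ≤ 1 := pow_le_one₀ (by positivity) ((div_le_one he₂).2 he)
  -- Halving the overlap keeps `w` above the contraction factor and below `1`, and ensures `w ≥
  -- 1/2`.
  set w := 1 - (εm d / εp d) ^ 2 / 2 with hw
  have hw2 : 1 / 2 ≤ w := by linarith
  have hw1 : w < 1 := by linarith
  have hνd := (hmin.nu_mem d hd).1
  obtain ⟨C, c, hC, hc, hFC⟩ := hbounds hμ
  refine ⟨(max √w (1 / 2)).toNNReal, ?_, fun μ' hμ' => ?_⟩
  · rw [Real.toNNReal_lt_one]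
    refine max_lt ?_ (by norm_num)
    rw [Real.sqrt_lt' one_pos]
    linarith
  obtain ⟨C', c', hC', hc', hFC'⟩ := hbounds hμ'
  refine ⟨(4 * (C * C') + 2 / (τ ^ 3 * (c * c'))).toNNReal, fun F h₁ h₂ h₃ n => ?_⟩
  have hF := h₁.globalDrift
  have hp : 0 < c * l ^ n := by positivity
  have hp' : 0 < c' * l ^ n := by positivity
  obtain ⟨hbd, hmass⟩ := hFC F hF h₂ n
  obtain ⟨hbd', hmass'⟩ := hFC' F hF h₂ n
  set A := ∫ x, Real.exp (V x) ∂μ with hA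
  set A' := ∫ x, Real.exp (V x) ∂μ' with hA'
  have hA1 : 1 ≤ A := one_le_integral_exp hV hV0 hμ
  have hA1' : 1 ≤ A' := one_le_integral_exp hV hV0 hμ'
  refine (vNorm_toSignedMeasure_sub_le hV
    (hF.integralExp_eta_lt_top hV hV0 hδ.le hμ.2 (hp.trans_le hmass))
    (hF.integralExp_eta_lt_top hV hV0 hδ.le hμ'.2 (hp'.trans_le hmass'))
    (K := max √w (1 / 2) ^ n * (4 * (C * C') + 2 / (τ ^ 3 * (c * c'))) * (A * A'))
    fun f hf hfv => ?_).trans (le_of_eq ?_)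
  · refine (hF.abs_integral_eta_sub_le hV hV0 hδ.le he₁ he (by linarith) (by linarith) hw1.le
      (h₂.locallyComparable h₃ hd) hμ hμ' hC.le hp hp' hbd hbd' hmass hmass' hf hfv
      (n / 4)).trans ?_
    rw [hτ4]
    exact pow_add_pow_le_of_quarter hw2 hw1.le hτ0 hτ1 hE hl0 hτE hc hc' (by positivity)
      (one_le_mul_of_one_le_of_one_le hA1 hA1') n
  · rw [← FeynmanKac.ofReal_integral_exp hV hμ.2, ← FeynmanKac.ofReal_integral_exp hV hμ'.2,
      ← mul_assoc, ENNReal.ofReal_mul (by positivity), ENNReal.ofReal_mul (by positivity),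
      ENNReal.ofReal_mul (by positivity), ENNReal.ofReal_pow (by positivity)]
    rfl
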